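/- Let $N\ge 1$, $\alpha>-1$, $0<a\le A$, and let $S$ be the space of symmetric real $N\times N$ matrices. Let $F:(\mathbb R^N\setminus\{0\})\times S\to\mathbb R$ satisfy (H1) $F(tp,\mu X)=|t|^\alpha\mu F(p,X)$ for all $p\ne0$, $X\in S$, $t\in\mathbb R\setminus\{0\}$, $\mu>0$, and $F(p,X)\le F(p,Y)$ whenever $p\neq 0$ and $X\le Y$; (H2) $a|p|^\alpha\operatorname{tr}Z\le F(p,M+Z)-F(p,M)\le A|p|^\alpha\operatorname{tr}Z$ for all $p\ne0$ and $M,Z\in S$ with $Z\ge0$. Let $\Omega\subset\mathbb R^N$ be a nonempty bounded open set. For $v$ bounded on $\overline\Omega$ let $v_\star(x)=\lim_{r\to0}\inf\{v(y):y\in\overline\Omega,\ |y-x|\le r\}$ be its lower semicontinuous envelope. Given $\lambda\in\mathbb R$ and $v$ bounded on $\overline\Omega$ with $v_\star>0$ in $\Omega$, we say that $F(\nabla v,D^2v)+\lambda v^{\alpha+1}\le0$ in $\Omega$ in the viscosity sense if for every $x_0\in\Omega$: - either $v_\star$ is equal to a constant $c$ on some open ball centred at $x_0$ and contained in $\Omega$,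 and then $-\lambda c^{\alpha+1}\ge0$; - or $v_\star$ is not constant on any such ball, and then for every $\varphi\in C^2(\Omega)$ such that $v_\star-\varphi$ has a local minimum at $x_0$ and $\nabla\varphi(x_0)\ne0$, one has $F(\nabla\varphi(x_0),D^2\varphi(x_0))\le-\lambda\, v_\star(x_0)^{\alpha+1}$. Let $$\bar\lambda=\sup\{\lambda\in\mathbb R:\ \exists\,\phi \text{ bounded on }\overline\Omega,\ \phi_\star>0 \text{ in }\Omega,\ F(\nabla\phi,D^2\phi)+\lambda\phi^{\alpha+1}\le0\text{ in }\Omega\text{ in the viscosity sense}\},$$ and let $R$ be the radius of the largest open ball contained in $\Omega$. Then there is a constant $C$, depending only on $a$, $A$, $N$ and $\alpha$, such that $$\bar\lambda\le\frac{C}{R^{\alpha+2}}.$$ -/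

import Mathlib

open Set Filter Topology

noncomputable section

/-- The Hessian matrix `D²φ(x)`. -/
def hessianMatrix {N : ℕ} (φ : EuclideanSpace ℝ (Fin N) → ℝ) (x : EuclideanSpace ℝ (Fin N)) :
    Matrix (Fin N) (Fin N) ℝ :=
  Matrix.of fun i j =>
    iteratedFDeriv ℝ 2 φ x ![EuclideanSpace.single i (1 : ℝ), EuclideanSpace.single j (1 : ℝ)]

/-- Hypothesis (H1) for `F : (ℝ^N ∖ {0}) × S → ℝ`, `S` the symmetric matrices: homogeneity and
degenerate ellipticity. `F` is a total function here, but only its values at `p ≠ 0` and at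
symmetric matrices are constrained (and used). -/
structure HypH1 {N : ℕ} (α : ℝ)
    (F : EuclideanSpace ℝ (Fin N) → Matrix (Fin N) (Fin N) ℝ → ℝ) : Prop where
  homogeneous : ∀ (p : EuclideanSpace ℝ (Fin N)) (X : Matrix (Fin N) (Fin N) ℝ) (t μ : ℝ),
    p ≠ 0 → X.IsSymm → t ≠ 0 → 0 < μ → F (t • p) (μ • X) = |t| ^ α * μ * F p X
  monotone : ∀ (p : EuclideanSpace ℝ (Fin N)) (X Y : Matrix (Fin N) (Fin N) ℝ),
    p ≠ 0 → X.IsSymm → Y.IsSymm → (Y - X).PosSemidef → F p X ≤ F p Y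

/-- Hypothesis (H2):
`a |p|^α tr Z ≤ F(p, M + Z) - F(p, M) ≤ A |p|^α tr Z` for `p ≠ 0`, `M` symmetric, `Z ≥ 0`. -/
def HypH2 {N : ℕ} (a A α : ℝ)
    (F : EuclideanSpace ℝ (Fin N) → Matrix (Fin N) (Fin N) ℝ → ℝ) : Prop :=
  ∀ (p : EuclideanSpace ℝ (Fin N)) (M Z : Matrix (Fin N) (Fin N) ℝ),
    p ≠ 0 → M.IsSymm → Z.PosSemidef →
      a * ‖p‖ ^ α * Z.trace ≤ F p (M + Z) - F p M ∧
        F p (M + Z) - F p M ≤ A * ‖p‖ ^ α * Z.trace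

/-- The lower semicontinuous envelope `v_⋆(x) = lim_{r → 0} inf {v(y) : y ∈ Ω̄, |y - x| ≤ r}`
of a function `v` on `Ω̄`. -/
def lscEnvelope {N : ℕ} (Ω : Set (EuclideanSpace ℝ (Fin N)))
    (v : EuclideanSpace ℝ (Fin N) → ℝ) (x : EuclideanSpace ℝ (Fin N)) : ℝ :=
  liminf v (𝓝[closure Ω] x)

/-- `v_⋆` is equal to the constant `c` on some open ball around `x₀` contained in `Ω`. -/
def EnvelopeConstNear {N : ℕ} (Ω : Set (EuclideanSpace ℝ (Fin N)))
    (v : EuclideanSpace ℝ (Fin N) → ℝ) (x₀ : EuclideanSpace ℝ (Fin N)) (c : ℝ) : Prop :=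
  ∃ δ : ℝ, 0 < δ ∧ Metric.ball x₀ δ ⊆ Ω ∧ ∀ y ∈ Metric.ball x₀ δ, lscEnvelope Ω v y = c

/-- `v`, bounded on `Ω̄`, is a viscosity supersolution of `F(∇v, D²v) = g(x, v)` in `Ω`: at every
point of `Ω`, either `v_⋆` is constant near the point, and the equation is tested with that
constant, or it is not, and it is tested with the `C²` functions of nonzero gradient that touch
`v_⋆` from below. -/
structure IsViscositySupersolution {N : ℕ}
    (F : EuclideanSpace ℝ (Fin N) → Matrix (Fin N) (Fin N) ℝ → ℝ)
    (Ω : Set (EuclideanSpace ℝ (Fin N))) (g : EuclideanSpace ℝ (Fin N) → ℝ → ℝ)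
    (v : EuclideanSpace ℝ (Fin N) → ℝ) : Prop where
  bounded : ∃ K : ℝ, ∀ x ∈ closure Ω, |v x| ≤ K
  test : ∀ x₀ ∈ Ω,
    (∃ c : ℝ, EnvelopeConstNear Ω v x₀ c ∧ 0 ≤ g x₀ c) ∨
    ((¬ ∃ c : ℝ, EnvelopeConstNear Ω v x₀ c) ∧
      ∀ φ : EuclideanSpace ℝ (Fin N) → ℝ, ContDiffOn ℝ 2 φ Ω →
        IsLocalMin (fun y => lscEnvelope Ω v y - φ y) x₀ → gradient φ x₀ ≠ 0 →
          F (gradient φ x₀) (hessianMatrix φ x₀) ≤ g x₀ (lscEnvelope Ω v x₀))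

/-- The set `E` of the real `l` for which there is `φ` with `φ_⋆ > 0` in `Ω` and
`F(∇φ, D²φ) + l φ^(α+1) ≤ 0` in `Ω` in the viscosity sense. -/
def eigenvalueSet {N : ℕ} (α : ℝ)
    (F : EuclideanSpace ℝ (Fin N) → Matrix (Fin N) (Fin N) ℝ → ℝ)
    (Ω : Set (EuclideanSpace ℝ (Fin N))) : Set ℝ :=
  {l | ∃ φ : EuclideanSpace ℝ (Fin N) → ℝ,
    (∀ x ∈ Ω, 0 < lscEnvelope Ω φ x) ∧
    IsViscositySupersolution F Ω (fun _ s => -l * s ^ (α + 1)) φ}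

/-- The first eigenvalue `λ̄ = sup E`, as an extended real number. -/
def firstEigenvalue {N : ℕ} (α : ℝ)
    (F : EuclideanSpace ℝ (Fin N) → Matrix (Fin N) (Fin N) ℝ → ℝ)
    (Ω : Set (EuclideanSpace ℝ (Fin N))) : EReal :=
  ⨆ l ∈ eigenvalueSet α F Ω, (l : EReal)

end

/-! Let `u` be the envelope of a supersolution for some `l > 0`. As `u > 0`, the equation fails for
constants, so `u` is nowhere locally constant. Put `ρ = R / 2`. Around each `z` near the centre of
the large ball, scale the bump `(1 - (|x - z| / ρ) ^ (2n + 4)) ^ 2` by the largest `m` that keeps it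
below `u`; it then touches `u` inside the ball.

If it touches at a point other than `z`, the gradient there is nonzero and the equation gives `l ≤ C
/ ρ ^ (α + 2)` (`le_of_supersolution_at`). If `l` exceeds this, every bump touches at its own
centre. Then `u z - u y ≤ K' |y - z|^2` for all `z`, `y` near the centre, so `u` has zero derivative
and is constant there, a contradiction.

The square makes the bump convex in the radial direction near the sphere, which keeps the contact
point away from it. The large exponent `2n + 4` controls the factor `|p| ^ α` near the centre when
`α < 0`. -/

theorem HypH2.le_apply_sub {N : ℕ} {a A α : ℝ}
    {F : EuclideanSpace ℝ (Fin N) → Matrix (Fin N) (Fin N) ℝ → ℝ}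
    (h1 : HypH1 α F) (h2 : HypH2 a A α F) {p : EuclideanSpace ℝ (Fin N)} (hp : p ≠ 0)
    {P Q : Matrix (Fin N) (Fin N) ℝ} (hP : P.PosSemidef) (hQ : Q.PosSemidef) :
    ‖p‖ ^ α * (a * P.trace - A * Q.trace) ≤ F p (P - Q) := by
  have hQs : (-Q).IsSymm := by
    have := hQ.isHermitian
    rw [Matrix.IsHermitian, Matrix.conjTranspose_eq_transpose_of_trivial] at this
    rw [Matrix.IsSymm, Matrix.transpose_neg, this]
  have h0 : F p 0 = 0 := by
    have := h1.homogeneous p 0 1 2 hp Matrix.isSymm_zero one_ne_zero two_pos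
    simp at this
    linarith
  -- Both increments start from `-Q`: adding `P` reaches `P - Q`, adding `Q` reaches `0`, where `F`
  -- vanishes by homogeneity.
  have hPb := (h2 p (-Q) P hp hQs hP).1
  have hQb := (h2 p (-Q) Q hp hQs hQ).2
  rw [neg_add_cancel, h0] at hQb
  rw [neg_add_eq_sub] at hPb
  linarith

/-! ### Derivatives of radial functions -/

section RadialFunctions

variable {N : ℕ} {G G' G'' : ℝ → ℝ} (z x : EuclideanSpace ℝ (Fin N))

theorem hasFDerivAt_comp_norm_sub_sq (hG : ∀ t, HasDerivAt G (G' t) t) :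
    HasFDerivAt (fun x => G (‖x - z‖ ^ 2)) ((2 * G' (‖x - z‖ ^ 2)) • innerSL ℝ (x - z)) x := by
  refine ((hG (‖x - z‖ ^ 2)).comp_hasFDerivAt x
    ((hasFDerivAt_id x).sub_const z).norm_sq).congr_fderiv ?_
  ext v
  simp
  ring

theorem gradient_comp_norm_sub_sq (hG : ∀ t, HasDerivAt G (G' t) t) :
    gradient (fun x => G (‖x - z‖ ^ 2)) x = (2 * G' (‖x - z‖ ^ 2)) • (x - z) := by
  apply HasGradientAt.gradient
  rw [hasGradientAt_iff_hasFDerivAt]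
  have h : InnerProductSpace.toDual ℝ (EuclideanSpace ℝ (Fin N))
      ((2 * G' (‖x - z‖ ^ 2)) • (x - z)) = (2 * G' (‖x - z‖ ^ 2)) • innerSL ℝ (x - z) := by
    ext v
    simp
  rw [h]
  exact hasFDerivAt_comp_norm_sub_sq z x hG

theorem hessianMatrix_comp_norm_sub_sq (hG : ∀ t, HasDerivAt G (G' t) t)
    (hG' : ∀ t, HasDerivAt G' (G'' t) t) :
    hessianMatrix (fun x => G (‖x - z‖ ^ 2)) x =
      (4 * G'' (‖x - z‖ ^ 2)) • Matrix.vecMulVec (x - z).ofLp (x - z).ofLp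
        + (2 * G' (‖x - z‖ ^ 2)) • (1 : Matrix (Fin N) (Fin N) ℝ) := by
  have h1 : fderiv ℝ (fun x => G (‖x - z‖ ^ 2)) =
      fun x => (2 * G' (‖x - z‖ ^ 2)) • innerSL ℝ (x - z) :=
    funext fun x => (hasFDerivAt_comp_norm_sub_sq z x hG).fderiv
  have h2 : HasFDerivAt (fun x => (2 * G' (‖x - z‖ ^ 2)) • innerSL ℝ (x - z)) _ x :=
    ((hasFDerivAt_comp_norm_sub_sq z x hG').const_mul 2).smul
      ((innerSL ℝ (E := EuclideanSpace ℝ (Fin N))).hasFDerivAt.comp x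
        ((hasFDerivAt_id x).sub_const z))
  ext i j
  rw [hessianMatrix, Matrix.of_apply, iteratedFDeriv_two_apply, h1, h2.fderiv]
  have h3 : innerSL ℝ (EuclideanSpace.single i (1 : ℝ)) (EuclideanSpace.single j (1 : ℝ)) =
      (1 : Matrix (Fin N) (Fin N) ℝ) i j := by
    simp [Matrix.one_apply, EuclideanSpace.inner_single_left]
  simp [h3, Matrix.vecMulVec_apply]
  simp [EuclideanSpace.inner_single_right]
  ring

end RadialFunctions

/-! ### The envelope, touching from below, and rigidity -/

theorem lscEnvelope_lowerSemicontinuousAt {N : ℕ} {Ω : Set (EuclideanSpace ℝ (Fin N))}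
    (hΩ : IsOpen Ω) {v : EuclideanSpace ℝ (Fin N) → ℝ} {K : ℝ} (hK : ∀ x ∈ closure Ω, |v x| ≤ K)
    {x : EuclideanSpace ℝ (Fin N)} (hx : x ∈ Ω) :
    LowerSemicontinuousAt (lscEnvelope Ω v) x := by
  intro c hc
  obtain ⟨c', hcc', hc'⟩ := exists_between hc
  have hnhds : ∀ y ∈ Ω, 𝓝[closure Ω] y = 𝓝 y := fun y hy =>
    nhdsWithin_eq_nhds.2 (mem_of_superset (hΩ.mem_nhds hy) subset_closure)
  have hev : ∀ᶠ y in 𝓝 x, c' < v y := by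
    have : ∀ᶠ y in 𝓝[closure Ω] x, c' < v y := by
      refine eventually_lt_of_lt_liminf hc' ?_
      refine isBoundedUnder_of_eventually_ge (a := -K) ?_
      filter_upwards [self_mem_nhdsWithin] with y hy using (abs_le.1 (hK y hy)).1
    rwa [hnhds x hx] at this
  filter_upwards [eventually_eventually_nhds.2 hev, hΩ.mem_nhds hx] with y hy hyΩ
  refine hcc'.trans_le ?_
  unfold lscEnvelope
  rw [hnhds y hyΩ]
  refine le_liminf_of_le ?_ (hy.mono fun _ h => h.le)
  refine IsBoundedUnder.isCoboundedUnder_ge (isBoundedUnder_of_eventually_le (a := K) ?_)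
  filter_upwards [hΩ.mem_nhds hyΩ] with w hw using (abs_le.1 (hK w (subset_closure hw))).2

theorem lscEnvelope_le {N : ℕ} {Ω : Set (EuclideanSpace ℝ (Fin N))}
    {v : EuclideanSpace ℝ (Fin N) → ℝ} {K : ℝ} (hK : ∀ x ∈ closure Ω, |v x| ≤ K)
    {x : EuclideanSpace ℝ (Fin N)} (hx : x ∈ Ω) : lscEnvelope Ω v x ≤ K := by
  have : (𝓝[closure Ω] x).NeBot :=
    mem_closure_iff_nhdsWithin_neBot.1 (subset_closure (subset_closure hx))
  have hle : ∀ᶠ y in 𝓝[closure Ω] x, v y ≤ K := by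
    filter_upwards [self_mem_nhdsWithin] with y hy using (abs_le.1 (hK y hy)).2
  have hge : ∀ᶠ y in 𝓝[closure Ω] x, -K ≤ v y := by
    filter_upwards [self_mem_nhdsWithin] with y hy using (abs_le.1 (hK y hy)).1
  exact liminf_le_of_frequently_le hle.frequently (isBoundedUnder_of_eventually_ge hge)

/-- A nonnegative continuous function that vanishes on a sphere can be scaled so as to touch a
positive lower semicontinuous function from below in the open ball. -/
theorem exists_touching_point {E : Type*} [PseudoMetricSpace E] [ProperSpace E]
    {u σ : E → ℝ} {z : E} {ρ : ℝ} (hρ : 0 < ρ)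
    (hu : ∀ x ∈ Metric.closedBall z ρ, LowerSemicontinuousAt u x)
    (hu0 : ∀ x ∈ Metric.closedBall z ρ, 0 < u x) (hσ : Continuous σ)
    (hσ0 : ∀ x, 0 ≤ σ x) (hσz : 0 < σ z) (hσb : ∀ x, dist x z = ρ → σ x = 0) :
    ∃ y ∈ Metric.ball z ρ, ∃ m > 0, u y = m * σ y ∧ 0 < σ y ∧
      ∀ x ∈ Metric.closedBall z ρ, m * σ x ≤ u x := by
  -- The scale `m` is the reciprocal of the maximum of `σ / u`, attained by upper semicontinuity.
  have husc : UpperSemicontinuousOn (fun x => σ x / u x) (Metric.closedBall z ρ) := by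
    intro x hx c hc
    have hc0 : 0 < c := (div_nonneg (hσ0 x) (hu0 x hx).le).trans_lt hc
    have h1 : σ x < c * u x := (div_lt_iff₀ (hu0 x hx)).1 hc
    obtain ⟨d, hd1, hd2⟩ := exists_between h1
    have h2 : ∀ᶠ y in 𝓝 x, d / c < u y := hu x hx _ ((div_lt_iff₀' hc0).2 hd2)
    filter_upwards [nhdsWithin_le_nhds h2, nhdsWithin_le_nhds 
        (hσ.continuousAt.eventually_lt_const hd1),
      self_mem_nhdsWithin] with y hy1 hy2 hy3
    rw [div_lt_iff₀ (hu0 y hy3)]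
    rw [div_lt_iff₀' hc0] at hy1
    linarith
  have hz : z ∈ Metric.closedBall z ρ := Metric.mem_closedBall_self hρ.le
  obtain ⟨y, hy, hmax⟩ := husc.exists_isMaxOn ⟨z, hz⟩ (isCompact_closedBall z ρ)
  have hpos : 0 < σ y / u y := (div_pos hσz (hu0 z hz)).trans_le (hmax hz)
  have hσy : 0 < σ y := by
    rcases (hσ0 y).lt_or_eq with h | h
    · exact h
    · rw [← h, zero_div] at hpos
      exact absurd hpos (lt_irrefl _)
  refine ⟨y, ?_, u y / σ y, div_pos (hu0 y hy) hσy, (div_mul_cancel₀ _ hσy.ne').symm, hσy, ?_⟩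
  · refine lt_of_le_of_ne hy fun h => hσy.ne' (hσb y h)
  · intro x hx
    have h : σ x / u x ≤ σ y / u y := hmax hx
    rw [div_le_div_iff₀ (hu0 x hx) (hu0 y hy)] at h
    rw [div_mul_eq_mul_div, div_le_iff₀ hσy]
    linarith

/-- Exchanging `y` and `z` makes the bound two-sided; being quadratic, it forces the derivative to
vanish. -/
theorem eqOn_ball_of_sub_le_norm_sq {E : Type*} [NormedAddCommGroup E] [NormedSpace ℝ E]
    {u : E → ℝ} {x₀ : E} {r K : ℝ}
    (h : ∀ z ∈ Metric.ball x₀ r, ∀ y ∈ Metric.ball x₀ r, u z - u y ≤ K * ‖y - z‖ ^ 2)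
    {x : E} (hx : x ∈ Metric.ball x₀ r) : u x = u x₀ := by
  have hr : 0 < r := Metric.pos_of_mem_ball hx
  have hder : ∀ y ∈ Metric.ball x₀ r, HasFDerivAt u (0 : E →L[ℝ] ℝ) y := by
    intro y hy
    refine HasFDerivAt.of_isLittleO ?_
    refine Asymptotics.IsBigO.trans_isLittleO (g := fun w => ‖w - y‖ ^ 2) ?_ ?_
    · refine Asymptotics.IsBigO.of_bound K ?_
      filter_upwards [Metric.isOpen_ball.mem_nhds hy] with w hw
      have h1 := h y hy w hw
      have h2 := h w hw y hy
      rw [norm_sub_rev] at h2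
      simp only [zero_apply, sub_zero, norm_pow, norm_norm]
      exact abs_le.2 ⟨by linarith, h2⟩
    · have := (Asymptotics.isLittleO_pow_id one_lt_two : (fun t : ℝ => t ^ 2) =o[𝓝 0] _)
      refine Asymptotics.IsLittleO.of_norm_right (this.comp_tendsto (k := fun w => ‖w - y‖) ?_)
      have hc : Continuous fun w => ‖w - y‖ := by fun_prop
      simpa using hc.tendsto y
  exact (convex_ball x₀ r).is_const_of_fderivWithin_eq_zero (𝕜 := ℝ)
    (fun y hy => (hder y hy).differentiableAt.differentiableWithinAt)
    (fun y hy => by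
      rw [fderivWithin_of_isOpen Metric.isOpen_ball hy, (hder y hy).fderiv]) hx
    (Metric.mem_ball_self hr)

/-! ### The radial profile and its numerical inequality -/

/-- The derivative of the profile `t ↦ m (1 - (t / b) ^ k) ^ 2` of the test functions. -/
theorem hasDerivAt_profile (m b : ℝ) (n : ℕ) (t : ℝ) :
    HasDerivAt (fun t => m * (1 - (t / b) ^ (n + 2)) ^ 2)
      (-(2 * m * (n + 2) * (t / b) ^ (n + 1) * (1 - (t / b) ^ (n + 2)) / b)) t := by
  have h := (((((hasDerivAt_id t).div_const b).pow (n + 2)).const_sub 1).pow 2).const_mul m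
  refine h.congr_deriv ?_
  simp
  ring

theorem hasDerivAt_profile_deriv (m b : ℝ) (n : ℕ) (t : ℝ) :
    HasDerivAt (fun t => -(2 * m * (n + 2) * (t / b) ^ (n + 1) * (1 - (t / b) ^ (n + 2)) / b))
      (2 * m * (n + 2) / b ^ 2 * ((n + 2) * (t / b) ^ (2 * n + 2)
        - (n + 1) * (t / b) ^ n * (1 - (t / b) ^ (n + 2)))) t := by
  have h1 := (((hasDerivAt_id t).div_const b).pow (n + 1)).const_mul (2 * m * (n + 2))
  have h2 := (((hasDerivAt_id t).div_const b).pow (n + 2)).const_sub 1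
  have h := ((h1.mul h2).div_const b).neg
  refine h.congr_deriv ?_
  simp
  ring

/-- The constant of the eigenvalue bound, before the choice of the radius. -/
noncomputable def profileConst (N n : ℕ) (a A α : ℝ) : ℝ :=
  let c := A * (8 * (n + 2) * (n + 1) + 4 * (n + 2) * N)
  let d := 8 * a * (n + 2) ^ 2
  c * (4 * (n + 2)) ^ (α + 1) / (4 * (n + 2)) / (d / (c + d)) ^ (α + 1)

theorem profileConst_pos {N n : ℕ} {a A α : ℝ} (ha : 0 < a) (hA : 0 < A) :
    0 < profileConst N n a A α := by
  unfold profileConst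
  positivity

/-- The numerical inequality behind the eigenvalue bound. Here `r` is the distance to the centre in
units of `ρ`, and `q` is the norm of the gradient of the test function. -/
theorem le_of_profile_inequality {N n : ℕ} {a A α l m ρ r q : ℝ} (ha : 0 < a) (hA : 0 < A)
    (hα : -1 < α) (hn : 1 ≤ (2 * n + 3) * (α + 1)) (hl : 0 < l) (hm : 0 < m) (hρ : 0 < ρ)
    (hr : 0 < r) (hr1 : r < 1)
    (hq : q = 4 * (n + 2) * (m * (1 - r ^ (2 * n + 4))) / ρ * r ^ (2 * n + 3))
    (h : l * (m * (1 - r ^ (2 * n + 4)) ^ 2) ^ (α + 1) ≤ q ^ α * (m / ρ ^ 2 * r ^ (2 * n + 2) *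
      (A * (8 * (n + 2) * (n + 1) + 4 * (n + 2) * N) * (1 - r ^ (2 * n + 4))
        - 8 * a * (n + 2) ^ 2 * r ^ (2 * n + 4)))) :
    l ≤ profileConst N n a A α / ρ ^ (α + 2) := by
  have hw : 0 < 1 - r ^ (2 * n + 4) := sub_pos.2 (pow_lt_one₀ hr.le hr1 (by omega))
  set c := A * (8 * (n + 2) * (n + 1) + 4 * (n + 2) * N : ℝ) with hc
  set d := 8 * a * (n + 2 : ℝ) ^ 2 with hd
  rw [show profileConst N n a A α =
    c * (4 * (n + 2)) ^ (α + 1) / (4 * (n + 2)) / (d / (c + d)) ^ (α + 1) from rfl]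
  have hc0 : 0 < c := by positivity
  have hd0 : 0 < d := by positivity
  generalize hwdef : 1 - r ^ (2 * n + 4) = w at *
  have hrw : r ^ (2 * n + 4) = 1 - w := by linarith
  rw [hrw] at h
  have hq0 : 0 < q := by rw [hq]; positivity
  have hα1 : 0 < α + 1 := by linarith
  -- The left side of `h` is positive, so the bracket is too; this bounds `w` below, away from the
  -- sphere.
  have hbr : 0 < c * w - d * (1 - w) := by
    have h1 : 0 < l * (m * w ^ 2) ^ (α + 1) := by positivity
    have h2 : 0 < m / ρ ^ 2 * r ^ (2 * n + 2) := by positivity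
    by_contra hcon
    have : q ^ α * (m / ρ ^ 2 * r ^ (2 * n + 2) * (c * w - d * (1 - w))) ≤ 0 :=
      mul_nonpos_of_nonneg_of_nonpos (by positivity)
        (mul_nonpos_of_nonneg_of_nonpos h2.le (not_lt.1 hcon))
    linarith
  have hδw : d / (c + d) ≤ w := by
    rw [div_le_iff₀ (by positivity)]
    linarith
  -- By `hn`, `q ^ (α + 1)` carries a full factor `r`, which cancels the `1 / r` that appears in
  -- `hmain`.
  have hpow : q ^ (α + 1) ≤ (4 * (n + 2)) ^ (α + 1) * (m * w) ^ (α + 1) / ρ ^ (α + 1) * r := by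
    rw [hq, Real.mul_rpow (by positivity) (by positivity), Real.div_rpow (by positivity) hρ.le,
      Real.mul_rpow (by positivity) (by positivity)]
    refine mul_le_mul_of_nonneg_left ?_ (by positivity)
    rw [← Real.rpow_natCast, ← Real.rpow_mul hr.le]
    push_cast
    exact (Real.rpow_le_rpow_of_exponent_ge hr hr1.le hn).trans_eq (Real.rpow_one r)
  have hmain : q ^ α * (m / ρ ^ 2 * r ^ (2 * n + 2) * (c * w - d * (1 - w))) ≤
      c * ((4 * (n + 2)) ^ (α + 1) * (m * w) ^ (α + 1) / ρ ^ (α + 1)) / (4 * (n + 2) * ρ) := by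
    calc q ^ α * (m / ρ ^ 2 * r ^ (2 * n + 2) * (c * w - d * (1 - w)))
        ≤ q ^ α * (m / ρ ^ 2 * r ^ (2 * n + 2) * (c * w)) := by
          have : 0 ≤ d * (1 - w) := by rw [← hrw]; positivity
          gcongr
          linarith
      _ = q ^ (α + 1) * (c / (4 * (n + 2) * ρ * r)) := by
          rw [Real.rpow_add_one hq0.ne', mul_assoc (q ^ α) q]
          congr 1
          rw [hq]
          field_simp
          ring
      _ ≤ _ := by
          refine (mul_le_mul_of_nonneg_right hpow (by positivity)).trans_eq ?_
          field_simp
  have hlhs : l * (m * w ^ 2) ^ (α + 1) = (l * w ^ (α + 1)) * (m * w) ^ (α + 1) := by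
    rw [pow_two, ← mul_assoc, Real.mul_rpow (by positivity) hw.le]
    ring
  have hfin : l * w ^ (α + 1) ≤
      c * (4 * (n + 2)) ^ (α + 1) / (4 * (n + 2)) / ρ ^ (α + 2) := by
    have hmw : 0 < (m * w) ^ (α + 1) := by positivity
    refine le_of_mul_le_mul_right ?_ hmw
    rw [← hlhs]
    refine (h.trans hmain).trans_eq ?_
    rw [show ρ ^ (α + 2) = ρ ^ (α + 1) * ρ by
      rw [← Real.rpow_add_one hρ.ne', add_assoc, one_add_one_eq_two]]
    field_simp
  have hδ : (d / (c + d)) ^ (α + 1) ≤ w ^ (α + 1) :=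
    Real.rpow_le_rpow (by positivity) hδw hα1.le
  rw [div_right_comm, le_div_iff₀ (by positivity)]
  exact (mul_le_mul_of_nonneg_left hδ hl.le).trans hfin

/-! ### Contact points and the eigenvalue bound -/

section Touching

variable {N n : ℕ} {a A α l m ρ : ℝ} {F : EuclideanSpace ℝ (Fin N) → Matrix (Fin N) (Fin N) ℝ → ℝ}

/-- If a test function with the profile above satisfies the supersolution inequality at a point of
the ball other than the centre, then `l` is bounded. -/
theorem le_of_supersolution_at (ha : 0 < a) (hA : 0 < A) (hα : -1 < α)
    (hn : 1 ≤ (2 * n + 3) * (α + 1)) (h1 : HypH1 α F) (h2 : HypH2 a A α F) (hl : 0 < l)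
    (hm : 0 < m) (hρ : 0 < ρ) {x z : EuclideanSpace ℝ (Fin N)} (hxz : x ≠ z)
    (hx : x ∈ Metric.ball z ρ)
    (h : gradient (fun x => m * (1 - (‖x - z‖ ^ 2 / ρ ^ 2) ^ (n + 2)) ^ 2) x ≠ 0 →
      F (gradient (fun x => m * (1 - (‖x - z‖ ^ 2 / ρ ^ 2) ^ (n + 2)) ^ 2) x)
        (hessianMatrix (fun x => m * (1 - (‖x - z‖ ^ 2 / ρ ^ 2) ^ (n + 2)) ^ 2) x) ≤
      -l * (m * (1 - (‖x - z‖ ^ 2 / ρ ^ 2) ^ (n + 2)) ^ 2) ^ (α + 1)) :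
    l ≤ profileConst N n a A α / ρ ^ (α + 2) := by
  have hy : 0 < ‖x - z‖ := norm_pos_iff.2 (sub_ne_zero.2 hxz)
  have hyρ : ‖x - z‖ < ρ := by rwa [mem_ball_iff_norm] at hx
  obtain ⟨r, hr⟩ : ∃ r, r = ‖x - z‖ / ρ := ⟨_, rfl⟩
  have hr0 : 0 < r := by rw [hr]; positivity
  have hr1 : r < 1 := by rw [hr]; exact (div_lt_one hρ).2 hyρ
  have hyr : ‖x - z‖ = r * ρ := by rw [hr]; field_simp
  have hs : ‖x - z‖ ^ 2 / ρ ^ 2 = r ^ 2 := by rw [hr, div_pow]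
  have hw : 0 < 1 - r ^ (2 * n + 4) := sub_pos.2 (pow_lt_one₀ hr0.le hr1 (by omega))
  rw [gradient_comp_norm_sub_sq z x (hasDerivAt_profile m (ρ ^ 2) n),
    hessianMatrix_comp_norm_sub_sq z x (hasDerivAt_profile m (ρ ^ 2) n)
      (hasDerivAt_profile_deriv m (ρ ^ 2) n)] at h
  simp only [hs, ← pow_mul] at h
  rw [show 2 * (n + 2) = 2 * n + 4 by ring, show 2 * (n + 1) = 2 * n + 2 by ring,
    show 2 * (2 * n + 2) = 4 * n + 4 by ring] at h
  obtain ⟨g, hg⟩ : ∃ g, g = 2 * m * (n + 2) * r ^ (2 * n + 2) * (1 - r ^ (2 * n + 4)) / ρ ^ 2 :=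
    ⟨_, rfl⟩
  have hg0 : 0 < g := by rw [hg]; positivity
  obtain ⟨e, he⟩ : ∃ e, e = 2 * m * (n + 2) * ((n + 2) * r ^ (4 * n + 4)) / ρ ^ (2 * 2) := ⟨_, rfl⟩
  obtain ⟨f, hf⟩ : ∃ f, f = 2 * m * (n + 2) * ((n + 1) * r ^ (2 * n) * (1 - r ^ (2 * n + 4))) /
    ρ ^ (2 * 2) := ⟨_, rfl⟩
  have he0 : 0 ≤ e := by rw [he]; positivity
  have hf0 : 0 ≤ f := by rw [hf]; positivity
  rw [← hg, show 2 * m * (n + 2) / ρ ^ (2 * 2) * ((n + 2) * r ^ (4 * n + 4) -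
    (n + 1) * r ^ (2 * n) * (1 - r ^ (2 * n + 4))) = e - f by rw [he, hf]; ring] at h
  set V : Matrix (Fin N) (Fin N) ℝ := Matrix.vecMulVec (x - z).ofLp (x - z).ofLp with hV
  have hVpos : V.PosSemidef := by
    simpa [hV] using Matrix.posSemidef_vecMulVec_self_star (x - z).ofLp
  have hVtr : V.trace = (r * ρ) ^ 2 := by
    rw [← hyr, hV, Matrix.trace_vecMulVec, EuclideanSpace.real_norm_sq_eq, dotProduct]
    simp [pow_two]
  have hp : (2 * -g) • (x - z) ≠ 0 := smul_ne_zero (by linarith) (sub_ne_zero.2 hxz)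
  have hpn : ‖(2 * -g) • (x - z)‖ =
      4 * (n + 2) * (m * (1 - r ^ (2 * n + 4))) / ρ * r ^ (2 * n + 3) := by
    rw [norm_smul, Real.norm_eq_abs, abs_of_neg (by linarith), hyr, hg]
    field_simp
    ring
  -- The Hessian as a difference of positive semidefinite matrices: `e` is the convex part, `f` and
  -- `g` the concave ones.
  have hX : (4 * (e - f)) • V + (2 * -g) • (1 : Matrix (Fin N) (Fin N) ℝ) =
      (4 * e) • V - ((4 * f) • V + (2 * g) • (1 : Matrix (Fin N) (Fin N) ℝ)) := by
    module
  have hF := HypH2.le_apply_sub h1 h2 hp (P := (4 * e) • V)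
    (Q := (4 * f) • V + (2 * g) • (1 : Matrix (Fin N) (Fin N) ℝ))
    (hVpos.smul (by positivity))
    ((hVpos.smul (by positivity)).add (Matrix.PosSemidef.one.smul (by positivity)))
  rw [hX] at h
  have hF' := hF.trans (h hp)
  rw [Matrix.trace_add, Matrix.trace_smul, Matrix.trace_smul, Matrix.trace_smul, hVtr,
    Matrix.trace_one, Fintype.card_fin] at hF'
  refine le_of_profile_inequality (N := N) ha hA hα hn hl hm hρ hr0 hr1 hpn ?_
  rw [neg_mul] at hF'
  refine (le_neg_of_le_neg hF').trans_eq ?_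
  rw [← mul_neg]
  congr 1
  simp only [smul_eq_mul]
  rw [he, hf, hg]
  field_simp
  ring

theorem le_of_supersolution_of_ball (ha : 0 < a) (hA : 0 < A) (hα : -1 < α)
    (hn : 1 ≤ (2 * n + 3) * (α + 1)) (h1 : HypH1 α F) (h2 : HypH2 a A α F) (hl : 0 < l)
    {Ω : Set (EuclideanSpace ℝ (Fin N))} (hΩ : IsOpen Ω) {x₀ : EuclideanSpace ℝ (Fin N)} {R : ℝ}
    (hR : 0 < R) (hball : Metric.ball x₀ R ⊆ Ω) {v : EuclideanSpace ℝ (Fin N) → ℝ}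
    (hpos : ∀ x ∈ Ω, 0 < lscEnvelope Ω v x)
    (hv : IsViscositySupersolution F Ω (fun _ s => -l * s ^ (α + 1)) v) :
    l ≤ profileConst N n a A α / (R / 2) ^ (α + 2) := by
  obtain ⟨K, hK⟩ := hv.bounded
  have hx₀ : x₀ ∈ Ω := hball (Metric.mem_ball_self hR)
  have htest : ∀ x ∈ Ω, (¬ ∃ c : ℝ, EnvelopeConstNear Ω v x c) ∧
      ∀ φ : EuclideanSpace ℝ (Fin N) → ℝ, ContDiffOn ℝ 2 φ Ω →
        IsLocalMin (fun y => lscEnvelope Ω v y - φ y) x → gradient φ x ≠ 0 →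
          F (gradient φ x) (hessianMatrix φ x) ≤ -l * lscEnvelope Ω v x ^ (α + 1) := by
    intro x hx
    refine (hv.test x hx).resolve_left ?_
    rintro ⟨c, ⟨δ, hδ, -, hc⟩, h⟩
    have hc0 : 0 < c := hc x (Metric.mem_ball_self hδ) ▸ hpos x hx
    have : 0 < l * c ^ (α + 1) := by positivity
    linarith
  by_contra hcon
  have hρ : 0 < R / 2 := by positivity
  -- With centres in radius `R / 4`, the balls of radius `R / 2` stay in `Ω` and each contains all
  -- the other centres.
  have hsub : ∀ z ∈ Metric.ball x₀ (R / 4), Metric.closedBall z (R / 2) ⊆ Ω := by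
    intro z hz
    refine (Metric.closedBall_subset_ball' ?_).trans hball
    rw [Metric.mem_ball] at hz
    linarith
  have hquad : ∀ z ∈ Metric.ball x₀ (R / 4), ∀ y ∈ Metric.ball x₀ (R / 4),
      lscEnvelope Ω v z - lscEnvelope Ω v y ≤ (2 * K / (R / 2) ^ 2) * ‖y - z‖ ^ 2 := by
    intro z hz y hy
    have hΩz := hsub z hz
    obtain ⟨x, hx, m, hm, hux, hσx, hle⟩ := exists_touching_point (u := lscEnvelope Ω v)
      (σ := fun x => (1 - (‖x - z‖ ^ 2 / (R / 2) ^ 2) ^ (n + 2)) ^ 2) hρ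
      (fun x hx => lscEnvelope_lowerSemicontinuousAt hΩ hK (hΩz hx))
      (fun x hx => hpos x (hΩz hx)) (by fun_prop) (fun x => by positivity) (by simp)
      (fun x hx => by
        rw [dist_eq_norm] at hx
        rw [hx, div_self (by positivity)]
        simp)
    have hxz : x = z := by
      by_contra hne
      refine hcon (le_of_supersolution_at ha hA hα hn h1 h2 hl hm hρ hne hx fun hgrad => ?_)
      rw [← hux]
      refine (htest x (hΩz (Metric.ball_subset_closedBall hx))).2 _ ?_ ?_ hgrad
      · have hsq : ContDiff ℝ 2 fun x : EuclideanSpace ℝ (Fin N) => ‖x - z‖ ^ 2 :=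
          (contDiff_id.sub contDiff_const).norm_sq ℝ
        exact (contDiff_const.mul
          ((contDiff_const.sub ((hsq.div_const _).pow _)).pow 2)).contDiffOn
      · filter_upwards [Metric.isOpen_ball.mem_nhds hx] with w hw
        rw [hux, sub_self, sub_nonneg]
        exact hle w (Metric.ball_subset_closedBall hw)
    subst hxz
    have hyx : ‖y - x‖ ≤ R / 2 := by
      rw [← dist_eq_norm]
      rw [Metric.mem_ball] at hy hz
      linarith [dist_triangle_right y x x₀]
    have hm' : lscEnvelope Ω v x = m := by simpa using hux
    have hmK : m ≤ K := hm' ▸ lscEnvelope_le hK (hΩz (Metric.mem_closedBall_self hρ.le))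
    have h3 := hle y (mem_closedBall_iff_norm.2 hyx)
    obtain ⟨s, hs⟩ : ∃ s, s = ‖y - x‖ ^ 2 / (R / 2) ^ 2 := ⟨_, rfl⟩
    have hs0 : 0 ≤ s := by rw [hs]; positivity
    have hs1 : s ≤ 1 := by
      rw [hs]
      exact div_le_one_of_le₀ (pow_le_pow_left₀ (norm_nonneg _) hyx 2) (by positivity)
    have hsk : s ^ (n + 2) ≤ s := pow_le_of_le_one hs0 hs1 (by omega)
    rw [← hs] at h3
    -- Only quadratic flatness of the bump at its centre is needed, as `s` is quadratic in `‖y -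
    -- x‖`.
    have h4 : 1 - 2 * s ≤ (1 - s ^ (n + 2)) ^ 2 := by nlinarith [sq_nonneg (s ^ (n + 2))]
    have h5 : m * (1 - 2 * s) ≤ m * (1 - s ^ (n + 2)) ^ 2 := mul_le_mul_of_nonneg_left h4 hm.le
    have h6 : m * s ≤ K * s := mul_le_mul_of_nonneg_right hmK hs0
    have h7 : 2 * K / (R / 2) ^ 2 * ‖y - x‖ ^ 2 = 2 * (K * s) := by rw [hs]; ring
    rw [hm', h7]
    linarith
  refine (htest x₀ hx₀).1 ⟨lscEnvelope Ω v x₀, R / 4, by positivity,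
    (Metric.ball_subset_ball (by linarith)).trans hball, fun y hy => ?_⟩
  exact eqOn_ball_of_sub_le_norm_sq hquad hy

end Touching

theorem mainTheorem4 (N : ℕ) (hN : 1 ≤ N) (a A α : ℝ) (ha : 0 < a) (haA : a ≤ A) (hα : -1 < α) :
    ∃ C : ℝ, ∀ F : EuclideanSpace ℝ (Fin N) → Matrix (Fin N) (Fin N) ℝ → ℝ,
      HypH1 α F → HypH2 a A α F →
      ∀ Ω : Set (EuclideanSpace ℝ (Fin N)), IsOpen Ω → Bornology.IsBounded Ω → Ω.Nonempty →
      ∀ R : ℝ, IsGreatest {r : ℝ | ∃ x, Metric.ball x r ⊆ Ω} R →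
        firstEigenvalue α F Ω ≤ ((C / R ^ (α + 2) : ℝ) : EReal) := by
  have hA : 0 < A := ha.trans_le haA
  have hα1 : 0 < α + 1 := by linarith
  obtain ⟨n, hn⟩ := exists_nat_ge (1 / (α + 1))
  have hn' : 1 ≤ (2 * (n : ℝ) + 3) * (α + 1) := by
    rw [div_le_iff₀ hα1] at hn
    nlinarith [mul_nonneg n.cast_nonneg hα1.le]
  -- The factor `2 ^ (α + 2)` comes from `ρ = R / 2`; `n` depends on `α` only.
  refine ⟨profileConst N n a A α * 2 ^ (α + 2), fun F h1 h2 Ω hΩ _ hne R hR => ?_⟩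
  obtain ⟨x₀, hx₀⟩ := hR.1
  have hR0 : 0 < R := by
    obtain ⟨y, hy⟩ := hne
    obtain ⟨ε, hε, hsub⟩ := Metric.isOpen_iff.1 hΩ y hy
    exact hε.trans_le (hR.2 ⟨y, hsub⟩)
  refine iSup₂_le fun l hl => EReal.coe_le_coe_iff.2 ?_
  have hC := profileConst_pos (N := N) (n := n) (α := α) ha hA
  rcases le_or_gt l 0 with hl0 | hl0
  · exact hl0.trans (by positivity)
  · obtain ⟨v, hpos, hv⟩ := hl
    have h := le_of_supersolution_of_ball ha hA hα hn' h1 h2 hl0 hΩ hR0 hx₀ hpos hv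
    rwa [Real.div_rpow hR0.le two_pos.le, div_div_eq_mul_div] at h
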